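/- \textbf{Definitions.} The rank of a group is the minimal cardinality of a generating set. A group is $k$-free (for an integer $k\ge 0$) if each of its subgroups of rank at most $k$ is free. The index of freedom $\mathrm{iof}(\Gamma)\in\{0,1,2,\dots,\infty\}$ of a group $\Gamma$ is the supremum of all integers $k\ge 0$ such that $\Gamma$ is $k$-free. The local rank $\mathrm{lr}(A)$ of a group $A$ is the smallest integer $r\ge 0$ such that every finitely generated subgroup of $A$ is contained in a subgroup of $A$ of rank $r$; if there is no such $r$, then $\mathrm{lr}(A)=\infty$. Let $A$ be a subgroup of a group $\Gamma$. It is \emph{strongly closable} (in $\Gamma$) if $\mathrm{lr}(A)<\mathrm{iof}(\Gamma)$, and \emph{closable} (in $\Gamma$) if $\mathrm{lr}(A)<\infty$ and there is an element $z\in\Gamma$ such that $\mathrm{lr}(\langle A,z\rangle)<\mathrm{iof}(\Gamma)$. An element $x\in\Gamma$ is \emph{$A$-admissible} if $\langle A,x\rangle$ is strongly closable and $\mathrm{lr}(\langle A,x\rangle)\le\mathrm{lr}(A)$. A finite sequence $x_1,\dots,x_m$ ($m\ge 1$) of elements of $\Gamma$ is \emph{$A$-admissible} if, for $i=1,\dots,m$,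 the element $x_i$ is $\langle A,x_1,\dots,x_{i-1}\rangle$-admissible. If $A$ is closable, $\mathrm{cl}(A)$ denotes the set of all $x\in\Gamma$ for which there is an $A$-admissible sequence $x_1,\dots,x_m$ with $x_m=x$. \textbf{Proposition.} Let $A$ be a closable subgroup of a group $\Gamma$. Then: \begin{enumerate} \item $\mathrm{cl}(A)$ is a strongly closable subgroup of $\Gamma$, and $\mathrm{lr}(\mathrm{cl}(A))\le\mathrm{lr}(A)$; \item $A\le\mathrm{cl}(A)$; \item for every subgroup $B\le A$ that is closable in $\Gamma$, we have $\mathrm{cl}(B)\le\mathrm{cl}(A)$; \item $\mathrm{cl}(A)$ is closable in $\Gamma$, so that $\mathrm{cl}(\mathrm{cl}(A))$ is defined, and $\mathrm{cl}(\mathrm{cl}(A))=\mathrm{cl}(A)$. \end{enumerate} -/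

import Mathlib

namespace ClosableSubgroups

/-- `G` is finitely generated and its rank, the minimal cardinality of a generating set, is `r`. -/
def HasRank (G : Type*) [Group G] (r : ℕ) : Prop :=
  ∃ _ : Group.FG G, Group.rank G = r

/-- A group is `k`-free if every subgroup of rank at most `k` is free. -/
def IsKFree (k : ℕ) (G : Type*) [Group G] : Prop :=
  ∀ (H : Subgroup G) (r : ℕ), HasRank H r → r ≤ k → IsFreeGroup H

/-- The index of freedom: the supremum of all `k` such that the group is `k`-free. -/
noncomputable def iof (G : Type*) [Group G] : ℕ∞ :=
  ⨆ (k : ℕ) (_ : IsKFree k G), (k : ℕ∞)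

/-- The local rank: the smallest `r` such that every finitely generated subgroup of the group is
contained in a subgroup of rank `r`, and `⊤` if there is no such `r`. -/
noncomputable def localRank (G : Type*) [Group G] : ℕ∞ :=
  ⨅ (r : ℕ) (_ : ∀ B : Subgroup G, B.FG → ∃ C : Subgroup G, B ≤ C ∧ HasRank C r), (r : ℕ∞)

variable {Γ : Type*} [Group Γ]

/-- The subgroup `⟨A, S⟩` generated by the subgroup `A` and the set `S`. -/
def adjoin (A : Subgroup Γ) (S : Set Γ) : Subgroup Γ :=
  Subgroup.closure ((A : Set Γ) ∪ S)

def IsStronglyClosable (A : Subgroup Γ) : Prop :=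
  localRank A < iof Γ

def IsClosable (A : Subgroup Γ) : Prop :=
  localRank A < ⊤ ∧ ∃ z : Γ, localRank (adjoin A {z}) < iof Γ

/-- The element `x` is `A`-admissible. -/
def IsAdmissible (A : Subgroup Γ) (x : Γ) : Prop :=
  IsStronglyClosable (adjoin A {x}) ∧ localRank (adjoin A {x}) ≤ localRank A

/-- The sequence `x` is `A`-admissible: each term is admissible for the subgroup generated by `A`
and the preceding terms. -/
def IsAdmissibleSeq (A : Subgroup Γ) {m : ℕ} (x : Fin m → Γ) : Prop :=
  ∀ i : Fin m, IsAdmissible (adjoin A (x '' {j | j < i})) (x i)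

/-- The closure `cl(A)`, as a set: all last terms of nonempty `A`-admissible sequences. (It is
only considered when `A` is closable.) -/
def cl (A : Subgroup Γ) : Set Γ :=
  {g | ∃ (m : ℕ) (x : Fin (m + 1) → Γ), IsAdmissibleSeq A x ∧ x (Fin.last m) = g}

end ClosableSubgroups

/-! Admissibility is not visibly monotone in the base subgroup, so it is compared with a condition
that is. Call `x` algebraic over `A` if substituting `x` kills a nontrivial word of `A * ℤ`. Over a
strongly closable `A`, algebraic elements are admissible (`IsStronglyClosable.isAdmissible`): a
nontrivial relation lowers the number of generators of a free image, by the Hopf property.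
Conversely, inside a strongly closable group, an adjunction that does not raise a finite local rank
is algebraic (`isAlgebraicOver_of_localRank_le`).

Hence chains of admissible adjunctions can be carried to larger strongly closable subgroups
(`Reach.sup`). The subgroups reached from a strongly closable `A₁ ≥ A` are therefore directed, and
`cl A` is their union. An equation has finitely many coefficients, so this union already contains
every element admissible over it, which gives idempotence. -/

/-! ### Free groups: residual finiteness and the Hopf property -/

/-- Left multiplication by a letter is a partial injection of the finite set of suffixes of the word
and extends to a permutation. Reading the word from `1` then ends at `w ≠ 1`. -/
theorem FreeGroup.exists_finite_perm_ne_one {α : Type*} (w : FreeGroup α) (hw : w ≠ 1) :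
    ∃ (V : Set (FreeGroup α)) (φ : FreeGroup α →* Equiv.Perm V), V.Finite ∧ φ w ≠ 1 := by
  classical
  obtain ⟨L, rfl⟩ : ∃ L, FreeGroup.mk L = w := ⟨w.toWord, FreeGroup.mk_toWord⟩
  set V : Set (FreeGroup α) := FreeGroup.mk '' {s | s ∈ L.tails} with hV
  have hfin : V.Finite := (List.finite_toSet L.tails).image _
  have := hfin.fintype
  let e (a : α) : {v : V // FreeGroup.of a * v ∈ V} ≃ {v : V // (FreeGroup.of a)⁻¹ * v ∈ V} :=
    { toFun v := ⟨⟨FreeGroup.of a * v.1, v.2⟩, by simp⟩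
      invFun v := ⟨⟨(FreeGroup.of a)⁻¹ * v.1, v.2⟩, by simp⟩
      left_inv v := by ext; simp
      right_inv v := by ext; simp }
  let φ : FreeGroup α →* Equiv.Perm V := FreeGroup.lift fun a ↦ (e a).extendSubtype
  have hof (a : α) (v : V) (h : FreeGroup.of a * (v : FreeGroup α) ∈ V) :
      φ (FreeGroup.of a) v = ⟨FreeGroup.of a * v, h⟩ := by
    simp only [φ, FreeGroup.lift_apply_of]
    rw [Equiv.extendSubtype_apply_of_mem (e a) v h]
    rfl
  have hmem (s : List (α × Bool)) (h : s <:+ L) : FreeGroup.mk s ∈ V :=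
    ⟨s, by simpa using h, rfl⟩
  have hone : (1 : FreeGroup α) ∈ V := hmem [] L.nil_suffix
  have key (s : List (α × Bool)) (h : s <:+ L) :
      φ (FreeGroup.mk s) ⟨1, hone⟩ = ⟨FreeGroup.mk s, hmem s h⟩ := by
    induction s with
    | nil => rfl
    | cons p s ih =>
      obtain ⟨a, b⟩ := p
      have hs : s <:+ L := (List.suffix_cons _ _).trans h
      have h1 : FreeGroup.mk ((a, b) :: s) = FreeGroup.mk [(a, b)] * FreeGroup.mk s := by
        simp [FreeGroup.mul_mk]
      have h2 := hmem _ h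
      have h3 : φ (FreeGroup.mk ((a, b) :: s)) ⟨1, hone⟩ =
          φ (FreeGroup.mk [(a, b)]) ⟨FreeGroup.mk s, hmem s hs⟩ := by
        rw [h1, MonoidHom.map_mul, Equiv.Perm.mul_apply, ih hs]
      rw [h3]
      rcases b with _ | _
      · have h4 : FreeGroup.mk [(a, false)] = (FreeGroup.of a)⁻¹ := rfl
        have h5 : FreeGroup.of a * FreeGroup.mk ((a, false) :: s) = FreeGroup.mk s := by
          rw [h1, h4, mul_inv_cancel_left]
        rw [h4, MonoidHom.map_inv, Equiv.Perm.inv_eq_iff_eq, hof a ⟨_, h2⟩ (h5 ▸ hmem s hs)]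
        exact Subtype.ext h5.symm
      · exact (hof a ⟨_, hmem s hs⟩ (h1 ▸ h2)).trans (Subtype.ext h1.symm)
  refine ⟨V, φ, hfin, fun h ↦ hw ?_⟩
  have := key L List.suffix_rfl
  rw [h] at this
  exact (congrArg Subtype.val this).symm

/-- Precomposition with `f` is injective on homomorphisms to the two-element group `Perm Bool`;
count both sides. -/
theorem FreeGroup.natCard_le_of_surjective {α β : Type*} [Finite α] (f : FreeGroup α →* FreeGroup β)
    (hf : Function.Surjective f) : Finite β ∧ Nat.card β ≤ Nat.card α := by
  classical
  have hinj : Function.Injective fun u : β → Equiv.Perm Bool ↦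
      FreeGroup.lift.symm ((FreeGroup.lift u).comp f) := fun u v h ↦
    FreeGroup.lift.injective <| (MonoidHom.cancel_right hf).1 <| FreeGroup.lift.symm.injective h
  have hfin : Finite (β → Equiv.Perm Bool) := Finite.of_injective _ hinj
  have hβ : Finite β := by
    by_contra hinf
    rw [not_finite_iff_infinite] at hinf
    exact not_finite (β → Equiv.Perm Bool)
  refine ⟨hβ, ?_⟩
  have := Nat.card_le_card_of_injective _ hinj
  rw [Nat.card_fun, Nat.card_fun, Nat.card_perm] at this
  exact (Nat.pow_le_pow_iff_right (by simp)).1 this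

/-- With equal finite ranks, precomposition with `f` is a bijection on homomorphisms to any finite
group. So each finite permutation action of the source factors through `f`, and residual finiteness
kills the kernel. -/
theorem FreeGroup.injective_of_surjective {α β : Type*} [Finite α] (f : FreeGroup α →* FreeGroup β)
    (hf : Function.Surjective f) (hcard : Nat.card α ≤ Nat.card β) : Function.Injective f := by
  obtain ⟨hβ, hle⟩ := FreeGroup.natCard_le_of_surjective f hf
  refine (injective_iff_map_eq_one f).2 fun w hw ↦ by_contra fun hne ↦ ?_
  obtain ⟨V, φ, hV, hφ⟩ := FreeGroup.exists_finite_perm_ne_one w hne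
  have hinj : Function.Injective fun u : β → Equiv.Perm V ↦
      FreeGroup.lift.symm ((FreeGroup.lift u).comp f) := fun u v h ↦
    FreeGroup.lift.injective <| (MonoidHom.cancel_right hf).1 <| FreeGroup.lift.symm.injective h
  have := hV.to_subtype
  have hbij := (Nat.bijective_iff_injective_and_card _).2 ⟨hinj, by
    rw [Nat.card_fun, Nat.card_fun, hle.antisymm hcard]⟩
  obtain ⟨u, hu⟩ := hbij.2 (FreeGroup.lift.symm φ)
  have hu' : (FreeGroup.lift u).comp f = φ := FreeGroup.lift.symm.injective hu
  exact hφ (by rw [← hu', MonoidHom.comp_apply, hw, MonoidHom.map_one])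

namespace ClosableSubgroups

/-! ### Numbers of generators and local rank -/

/-- The subgroup `H` is generated by at most `n` elements. -/
def IsGenLE {G : Type*} [Group G] (H : Subgroup G) (n : ℕ) : Prop :=
  ∃ S : Finset G, S.card ≤ n ∧ Subgroup.closure (S : Set G) = H

theorem IsGenLE.map {G G' : Type*} [Group G] [Group G'] {H : Subgroup G} {n : ℕ}
    (h : IsGenLE H n) (f : G →* G') : IsGenLE (H.map f) n := by
  classical
  obtain ⟨S, hS, rfl⟩ := h
  exact ⟨S.image f, Finset.card_image_le.trans hS, by rw [MonoidHom.map_closure, Finset.coe_image]⟩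

theorem IsGenLE.mono {G : Type*} [Group G] {H : Subgroup G} {m n : ℕ} (h : IsGenLE H m)
    (hmn : m ≤ n) : IsGenLE H n := by
  obtain ⟨S, hS, rfl⟩ := h
  exact ⟨S, hS.trans hmn, rfl⟩

theorem IsGenLE.fg {G : Type*} [Group G] {H : Subgroup G} {n : ℕ} (h : IsGenLE H n) : H.FG := by
  obtain ⟨S, -, hS⟩ := h
  exact ⟨S, hS⟩

theorem exists_isGenLE_of_fg {G : Type*} [Group G] {H : Subgroup G} (h : H.FG) :
    ∃ n, IsGenLE H n := by
  obtain ⟨S, hS⟩ := h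
  exact ⟨S.card, S, le_rfl, hS⟩

theorem isGenLE_iff_rank {G : Type*} [Group G] {H : Subgroup G} {n : ℕ} :
    IsGenLE H n ↔ ∃ r ≤ n, HasRank H r := by
  constructor
  · rintro ⟨S, hS, rfl⟩
    have hfg : Group.FG (Subgroup.closure (S : Set G)) := Group.closure_finset_fg S
    exact ⟨_, (Subgroup.rank_closure_finset_le_card S).trans hS, hfg, rfl⟩
  · classical
    rintro ⟨r, hr, hfg, rfl⟩
    obtain ⟨S, hS, hS'⟩ := Group.rank_spec H
    have : IsGenLE (⊤ : Subgroup H) n := ⟨S, hS.trans_le hr, hS'⟩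
    simpa [← MonoidHom.range_eq_map] using this.map H.subtype

/-- If the free image of an `(m + 1)`-generated group under a non-injective homomorphism is
`m`-generated. -/
theorem IsGenLE.map_of_not_injective {G G' : Type*} [Group G] [Group G'] {K : Subgroup G} {m : ℕ}
    (hK : IsGenLE K (m + 1)) (f : G →* G') (hfree : IsFreeGroup (K.map f)) {w : G} (hwK : w ∈ K)
    (hw : w ≠ 1) (hfw : f w = 1) : IsGenLE (K.map f) m := by
  classical
  obtain ⟨S, hS, rfl⟩ := hK
  set K := Subgroup.closure (S : Set G)
  let π : FreeGroup S →* G := FreeGroup.lift (fun s ↦ (s : G))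
  have hπ : π.range = K := by
    rw [FreeGroup.range_lift_eq_closure]; simp [K]
  have hrange : (f.comp π).range = K.map f := by rw [MonoidHom.range_comp, hπ]
  let q : FreeGroup S →* K.map f := (f.comp π).codRestrict _ fun x ↦ by
    rw [← hrange]; exact ⟨x, rfl⟩
  have hq : Function.Surjective q := by
    rintro ⟨y, hy⟩
    rw [← hrange] at hy
    obtain ⟨x, rfl⟩ := hy
    exact ⟨x, rfl⟩
  let X := IsFreeGroup.Generators (K.map f)
  let e : FreeGroup X ≃* K.map f := IsFreeGroup.mulEquiv _
  let q' : FreeGroup S →* FreeGroup X := e.symm.toMonoidHom.comp q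
  have hq' : Function.Surjective q' := e.symm.surjective.comp hq
  obtain ⟨hX, hle⟩ := FreeGroup.natCard_le_of_surjective q' hq'
  have hSc : Nat.card S = S.card := by simp
  have hlt : Nat.card X < Nat.card S := by
    by_contra! hcon
    have hinj := FreeGroup.injective_of_surjective q' hq' hcon
    rw [← hπ] at hwK
    obtain ⟨v, rfl⟩ := hwK
    refine hw ?_
    have : q v = 1 := Subtype.ext hfw
    have : v = 1 := hinj (by simp [q', this])
    rw [this, map_one]
  have := Fintype.ofFinite X
  let b : X → G' := fun x ↦ (e (FreeGroup.of x) : G')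
  refine ⟨Finset.univ.image b, ?_, ?_⟩
  · refine Finset.card_image_le.trans ?_
    rw [Finset.card_univ, ← Nat.card_eq_fintype_card]
    omega
  · have h1 : (K.map f).subtype.comp e.toMonoidHom = FreeGroup.lift b := by
      ext x; simp [b]
    have h2 := congrArg MonoidHom.range h1
    rw [FreeGroup.range_lift_eq_closure, MonoidHom.range_comp] at h2
    rw [Finset.coe_image, Finset.coe_univ, Set.image_univ, ← h2,
      MonoidHom.range_eq_top.2 e.surjective]
    simp [← MonoidHom.range_eq_map]


variable {Γ : Type*} [Group Γ]

theorem IsGenLE.sup {H K : Subgroup Γ} {m n : ℕ} (hH : IsGenLE H m) (hK : IsGenLE K n) :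
    IsGenLE (H ⊔ K) (m + n) := by
  classical
  obtain ⟨S, hS, rfl⟩ := hH
  obtain ⟨T, hT, rfl⟩ := hK
  exact ⟨S ∪ T, (Finset.card_union_le S T).trans (add_le_add hS hT),
    by rw [Finset.coe_union, Subgroup.closure_union]⟩

theorem isGenLE_zpowers (x : Γ) : IsGenLE (Subgroup.zpowers x) 1 :=
  ⟨{x}, by simp, by rw [Finset.coe_singleton, Subgroup.zpowers_eq_closure]⟩

theorem IsGenLE.eq_bot {H : Subgroup Γ} (h : IsGenLE H 0) : H = ⊥ := by
  obtain ⟨S, hS, rfl⟩ := h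
  simp [Finset.card_eq_zero.1 (Nat.le_zero.1 hS)]

theorem fg_zpowers (x : Γ) : (Subgroup.zpowers x).FG := (isGenLE_zpowers x).fg

theorem fg_map {G G' : Type*} [Group G] [Group G'] {H : Subgroup G} (h : H.FG) (f : G →* G') :
    (H.map f).FG :=
  let ⟨_, hn⟩ := exists_isGenLE_of_fg h
  (hn.map f).fg

theorem IsGenLE.subgroupOf {C H : Subgroup Γ} {n : ℕ} (hC : IsGenLE C n) (hCH : C ≤ H) :
    IsGenLE (C.subgroupOf H) n := by
  obtain ⟨r, hr, hfg, hrank⟩ := isGenLE_iff_rank.1 hC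
  let e := Subgroup.subgroupOfEquivOfLe hCH
  have hfg' : Group.FG (C.subgroupOf H) :=
    Group.fg_of_surjective (f := e.symm.toMonoidHom) e.symm.surjective
  exact isGenLE_iff_rank.2 ⟨r, hr, hfg', (Group.rank_congr e).trans hrank⟩

theorem isFreeGroup_of_isGenLE {n : ℕ} (hn : (n : ℕ∞) ≤ iof Γ) {H : Subgroup Γ}
    (hH : IsGenLE H n) : IsFreeGroup H := by
  rcases n with _ | k
  · rw [hH.eq_bot]
    exact IsFreeGroup.ofMulEquiv (G := FreeGroup Empty) MulEquiv.ofUnique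
  -- The strict bound for the predecessor of `n` yields some `j ≥ n` with `Γ` `j`-free, whether or
  -- not the supremum is attained.
  · have hlt : (k : ℕ∞) < iof Γ := lt_of_lt_of_le (by exact_mod_cast k.lt_succ_self) hn
    obtain ⟨j, hj⟩ := lt_iSup_iff.1 hlt
    obtain ⟨hfree, hkj⟩ := lt_iSup_iff.1 hj
    obtain ⟨r, hr, hrank⟩ := isGenLE_iff_rank.1 hH
    have : k < j := by exact_mod_cast hkj
    exact hfree H r hrank (by omega)

/-- Every finitely generated subgroup of `H` lies in a subgroup of `H` that is generated by at
most `n` elements. -/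
def LocalRankLE (H : Subgroup Γ) (n : ℕ) : Prop :=
  ∀ D : Subgroup Γ, D ≤ H → D.FG → ∃ C : Subgroup Γ, D ≤ C ∧ C ≤ H ∧ IsGenLE C n

/-- Exact rank may be relaxed to "at most": for the least bound `r = k + 1`, some `B₀` lies in no
`k`-generated subgroup, and enlarging `B` by `B₀` forces rank exactly `r`. -/
theorem localRank_le_iff {G : Type*} [Group G] {n : ℕ} :
    localRank G ≤ n ↔ ∀ B : Subgroup G, B.FG → ∃ C : Subgroup G, B ≤ C ∧ IsGenLE C n := by
  classical
  constructor
  · intro h B hB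
    have hlt : localRank G < ((n + 1 : ℕ) : ℕ∞) :=
      h.trans_lt (by exact_mod_cast n.lt_succ_self)
    obtain ⟨r, hr⟩ := iInf_lt_iff.1 hlt
    obtain ⟨hr, hrn⟩ := iInf_lt_iff.1 hr
    obtain ⟨C, hBC, hC⟩ := hr B hB
    exact ⟨C, hBC, isGenLE_iff_rank.2 ⟨r, Nat.lt_succ_iff.1 (by exact_mod_cast hrn), hC⟩⟩
  · intro h
    have hex : ∃ r, ∀ B : Subgroup G, B.FG → ∃ C : Subgroup G, B ≤ C ∧ IsGenLE C r := ⟨n, h⟩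
    set r := Nat.find hex with hr
    refine le_trans (b := (r : ℕ∞)) ?_ (by exact_mod_cast Nat.find_min' hex h)
    refine iInf₂_le_of_le r (fun B hB ↦ ?_) le_rfl
    rcases hr0 : r with _ | k
    · obtain ⟨C, hBC, hC⟩ := Nat.find_spec hex B hB
      rw [← hr, hr0] at hC
      obtain ⟨r', hr', hrank⟩ := isGenLE_iff_rank.1 hC
      exact ⟨C, hBC, Nat.le_zero.1 hr' ▸ hrank⟩
    · have hmin := Nat.find_min hex (m := k) (by omega)
      push Not at hmin
      obtain ⟨B₀, hB₀, hk⟩ := hmin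
      obtain ⟨C, hBC, hC⟩ := Nat.find_spec hex (B ⊔ B₀) (hB.sup hB₀)
      rw [← hr, hr0] at hC
      obtain ⟨r', hr', hrank⟩ := isGenLE_iff_rank.1 hC
      have hnot : ¬ r' ≤ k := fun hle ↦
        hk C (le_sup_right.trans hBC) (isGenLE_iff_rank.2 ⟨r', hle, hrank⟩)
      obtain rfl : r' = k + 1 := by omega
      exact ⟨C, le_sup_left.trans hBC, hrank⟩

theorem localRank_subgroup_le_iff {H : Subgroup Γ} {n : ℕ} :
    localRank H ≤ n ↔ LocalRankLE H n := by
  rw [localRank_le_iff]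
  constructor
  · intro h D hD hfg
    obtain ⟨C, hDC, hC⟩ := h (D.subgroupOf H) 
      (let ⟨_, hn⟩ := exists_isGenLE_of_fg hfg; (hn.subgroupOf hD).fg)
    refine ⟨C.map H.subtype, ?_, Subgroup.map_subtype_le C, hC.map _⟩
    rw [← Subgroup.map_subgroupOf_eq_of_le hD]
    exact Subgroup.map_mono hDC
  · intro h B hB
    obtain ⟨C, hBC, hCH, hC⟩ := h (B.map H.subtype) (Subgroup.map_subtype_le B) (fg_map hB _)
    refine ⟨C.subgroupOf H, ?_, ?_⟩
    · rwa [Subgroup.subgroupOf, ← Subgroup.map_le_iff_le_comap]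
    · exact hC.subgroupOf hCH

theorem adjoin_singleton (A : Subgroup Γ) (x : Γ) : adjoin A {x} = A ⊔ Subgroup.zpowers x := by
  rw [adjoin, Subgroup.closure_union, Subgroup.closure_eq, Subgroup.zpowers_eq_closure]

theorem adjoin_singleton_of_mem {A : Subgroup Γ} {x : Γ} (hx : x ∈ A) : adjoin A {x} = A := by
  rw [adjoin_singleton, sup_eq_left, Subgroup.zpowers_le]
  exact hx

theorem le_adjoin (A : Subgroup Γ) (S : Set Γ) : A ≤ adjoin A S :=
  fun _ ha ↦ Subgroup.subset_closure (Or.inl ha)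

theorem mem_adjoin_singleton (A : Subgroup Γ) (x : Γ) : x ∈ adjoin A {x} :=
  Subgroup.subset_closure (Or.inr rfl)

theorem exists_fg_le_mem_sup {A Z : Subgroup Γ} {g : Γ} (hg : g ∈ A ⊔ Z) :
    ∃ B ≤ A, B.FG ∧ g ∈ B ⊔ Z := by
  rw [Subgroup.sup_eq_closure] at hg
  induction hg using Subgroup.closure_induction with
  | mem y hy =>
    rcases hy with hy | hy
    · exact ⟨_, Subgroup.zpowers_le.2 hy, fg_zpowers y,
        Subgroup.mem_sup_left (Subgroup.mem_zpowers y)⟩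
    · exact ⟨⊥, bot_le, Subgroup.FG.bot, Subgroup.mem_sup_right hy⟩
  | one => exact ⟨⊥, bot_le, Subgroup.FG.bot, one_mem _⟩
  | mul y z _ _ hy hz =>
    obtain ⟨B, hB, hBfg, hyB⟩ := hy
    obtain ⟨C, hC, hCfg, hzC⟩ := hz
    exact ⟨B ⊔ C, sup_le hB hC, hBfg.sup hCfg,
      mul_mem (sup_le_sup_right le_sup_left Z hyB) (sup_le_sup_right le_sup_right Z hzC)⟩
  | inv y _ hy =>
    obtain ⟨B, hB, hBfg, hyB⟩ := hy
    exact ⟨B, hB, hBfg, inv_mem hyB⟩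

theorem exists_fg_le_sup {A Z D : Subgroup Γ} (hD : D.FG) (hDA : D ≤ A ⊔ Z) :
    ∃ B ≤ A, B.FG ∧ D ≤ B ⊔ Z := by
  classical
  obtain ⟨S, rfl⟩ := hD
  rw [Subgroup.closure_le] at hDA
  simp only [Subgroup.closure_le]
  induction S using Finset.induction_on with
  | empty => exact ⟨⊥, bot_le, Subgroup.FG.bot, by simp⟩
  | insert s S _ ih =>
    rw [Finset.coe_insert, Set.insert_subset_iff] at hDA
    obtain ⟨B, hB, hBfg, hSB⟩ := ih hDA.2
    obtain ⟨C, hC, hCfg, hsC⟩ := exists_fg_le_mem_sup hDA.1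
    refine ⟨B ⊔ C, sup_le hB hC, hBfg.sup hCfg, ?_⟩
    rw [Finset.coe_insert, Set.insert_subset_iff]
    exact ⟨sup_le_sup_right le_sup_right Z hsC,
      hSB.trans fun y hy ↦ sup_le_sup_right le_sup_left Z hy⟩

/-! ### Words in one indeterminate and algebraic elements -/

variable (Γ) in
/-- The free product of `Γ` and the infinite cyclic group. -/
abbrev Words : Type _ := Monoid.Coprod Γ (FreeGroup Unit)

variable (Γ) in
/-- The indeterminate: the generator of the infinite cyclic free factor. -/
def indet : Words Γ := Monoid.Coprod.inr (FreeGroup.of ())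

variable (Γ) in
theorem indet_ne_one : indet Γ ≠ 1 := fun h ↦
  FreeGroup.of_ne_one () (Monoid.Coprod.inr_injective (h.trans (map_one _).symm))

/-- Substitution of `x` for the indeterminate. -/
def subst (x : Γ) : Words Γ →* Γ :=
  Monoid.Coprod.lift (MonoidHom.id Γ) (FreeGroup.lift fun _ ↦ x)

@[simp] theorem subst_inl (x g : Γ) : subst x (Monoid.Coprod.inl g) = g := rfl

@[simp] theorem subst_indet (x : Γ) : subst x (indet Γ) = x := by simp [subst, indet]

/-- The words whose coefficients lie in `A`. -/
def wordsOver (A : Subgroup Γ) : Subgroup (Words Γ) :=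
  A.map Monoid.Coprod.inl ⊔ Subgroup.zpowers (indet Γ)

theorem wordsOver_mono {A B : Subgroup Γ} (h : A ≤ B) : wordsOver A ≤ wordsOver B :=
  sup_le_sup_right (Subgroup.map_mono h) _

theorem inl_mem_wordsOver {A : Subgroup Γ} {a : Γ} (ha : a ∈ A) :
    Monoid.Coprod.inl a ∈ wordsOver A :=
  Subgroup.mem_sup_left (Subgroup.mem_map_of_mem _ ha)

theorem indet_mem_wordsOver (A : Subgroup Γ) : indet Γ ∈ wordsOver A :=
  Subgroup.mem_sup_right (Subgroup.mem_zpowers _)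

theorem map_subst_wordsOver (A : Subgroup Γ) (x : Γ) :
    (wordsOver A).map (subst x) = A ⊔ Subgroup.zpowers x := by
  rw [wordsOver, Subgroup.map_sup, Subgroup.map_map, MonoidHom.map_zpowers, subst_indet]
  congr 1
  exact Subgroup.map_id A

theorem IsGenLE.wordsOver {A : Subgroup Γ} {n : ℕ} (hA : IsGenLE A n) :
    IsGenLE (wordsOver A) (n + 1) :=
  (hA.map _).sup (isGenLE_zpowers _)

/-- `x` satisfies a nontrivial equation with coefficients in `A`. -/
def IsAlgebraicOver (A : Subgroup Γ) (x : Γ) : Prop :=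
  ∃ w ∈ wordsOver A, w ≠ 1 ∧ subst x w = 1

theorem IsAlgebraicOver.mono {A B : Subgroup Γ} {x : Γ} (h : IsAlgebraicOver A x) (hAB : A ≤ B) :
    IsAlgebraicOver B x := by
  obtain ⟨w, hw, h⟩ := h
  exact ⟨w, wordsOver_mono hAB hw, h⟩

theorem IsAlgebraicOver.exists_fg {A : Subgroup Γ} {x : Γ} (h : IsAlgebraicOver A x) :
    ∃ B ≤ A, B.FG ∧ IsAlgebraicOver B x := by
  obtain ⟨w, hw, h⟩ := h
  obtain ⟨B', hB', hfg, hwB⟩ := exists_fg_le_mem_sup hw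
  -- Substituting `1` retracts the free product onto `Γ`, which turns `B'` back into a subgroup of
  -- `Γ`.
  have hsub : (B'.map (subst (1 : Γ))).map Monoid.Coprod.inl = B' := by
    ext b
    constructor
    · rintro ⟨_, ⟨b', hb', rfl⟩, rfl⟩
      obtain ⟨a, -, rfl⟩ := hB' hb'
      exact hb'
    · intro hb
      obtain ⟨a, -, rfl⟩ := hB' hb
      exact ⟨a, ⟨_, hb, rfl⟩, rfl⟩
  refine ⟨B'.map (subst 1), ?_, fg_map hfg _, w, by rwa [ClosableSubgroups.wordsOver, hsub], h⟩
  rintro _ ⟨b, hb, rfl⟩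
  obtain ⟨a, ha, rfl⟩ := hB' hb
  exact ha

/-! ### Admissible versus algebraic -/

theorem IsStronglyClosable.exists_nat {A : Subgroup Γ} (hA : IsStronglyClosable A) :
    ∃ n : ℕ, localRank A = n ∧ ((n + 1 : ℕ) : ℕ∞) ≤ iof Γ := by
  obtain ⟨n, hn⟩ := ENat.ne_top_iff_exists.1 (ne_top_of_lt hA)
  refine ⟨n, hn.symm, ?_⟩
  rw [IsStronglyClosable, ← hn] at hA
  exact_mod_cast Order.add_one_le_of_lt hA

theorem IsStronglyClosable.isFreeGroup_of_fg {A D : Subgroup Γ} (hA : IsStronglyClosable A)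
    (hDA : D ≤ A) (hD : D.FG) : IsFreeGroup D := by
  obtain ⟨n, hn, hiof⟩ := hA.exists_nat
  obtain ⟨C, hDC, -, hC⟩ := localRank_subgroup_le_iff.1 hn.le D hDA hD
  have : IsFreeGroup C := isFreeGroup_of_isGenLE hiof (hC.mono n.le_succ)
  exact IsFreeGroup.ofMulEquiv (Subgroup.subgroupOfEquivOfLe hDC)

/-- Let an `n`-generated `C` contain the coefficients of an equation for `x`. Then `⟨C, x⟩` is free,
since `n + 1 ≤ iof Γ`, and is the image of the `(n + 1)`-generated `C * ℤ` under a non-injective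
map, so `n` generators suffice. -/
theorem IsStronglyClosable.isAdmissible {A : Subgroup Γ} {x : Γ} (hA : IsStronglyClosable A)
    (hx : IsAlgebraicOver A x) : IsAdmissible A x := by
  obtain ⟨n, hn, hiof⟩ := hA.exists_nat
  suffices h : localRank (adjoin A {x}) ≤ localRank A from ⟨h.trans_lt hA, h⟩
  rw [hn, localRank_subgroup_le_iff, adjoin_singleton]
  intro D hDA hD
  obtain ⟨D₀, hD₀A, hD₀, hDD₀⟩ := exists_fg_le_sup hD hDA
  obtain ⟨B, hBA, hB, hBx⟩ := hx.exists_fg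
  obtain ⟨C, hC, hCA, hCn⟩ :=
    localRank_subgroup_le_iff.1 hn.le (D₀ ⊔ B) (sup_le hD₀A hBA) (hD₀.sup hB)
  refine ⟨C ⊔ Subgroup.zpowers x, hDD₀.trans (sup_le_sup_right (le_sup_left.trans hC) _),
    sup_le_sup_right hCA _, ?_⟩
  obtain ⟨w, hw, hw1, hwx⟩ := hBx.mono (le_sup_right.trans hC)
  rw [← map_subst_wordsOver]
  exact hCn.wordsOver.map_of_not_injective (subst x)
    (isFreeGroup_of_isGenLE hiof (hCn.wordsOver.map _)) hw hw1 hwx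

/-- If `x` were transcendental, `⟨B, x⟩` would be a copy of `B * ℤ`. A `(k + 1)`-generated subgroup
containing `B₀` and `x` lifts there; setting the indeterminate to `1` kills a nontrivial element, so
the image in `B`, still containing `B₀`, needs only `k` generators. -/
theorem isAlgebraicOver_of_localRank_le {A B : Subgroup Γ} {x : Γ} (hA : IsStronglyClosable A)
    (hBA : B ≤ A) (hB : localRank B < ⊤) (hx : localRank (adjoin B {x}) ≤ localRank B) :
    IsAlgebraicOver B x := by
  classical
  obtain ⟨r, hr⟩ := ENat.ne_top_iff_exists.1 hB.ne
  rw [← hr, localRank_subgroup_le_iff, adjoin_singleton] at hx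
  by_contra hcon
  have hinj {v w : Words Γ} (hv : v ∈ wordsOver B) (hw : w ∈ wordsOver B)
      (h : subst x v = subst x w) : v = w := by
    by_contra hne
    exact hcon ⟨v * w⁻¹, mul_mem hv (inv_mem hw), fun h1 ↦ hne (mul_inv_eq_one.1 h1),
      by rw [map_mul, map_inv, h, mul_inv_cancel]⟩
  rcases r with _ | k
  · obtain ⟨C, hxC, -, hC⟩ := hx _ le_sup_right (fg_zpowers x)
    rw [hC.eq_bot, Subgroup.zpowers_le, Subgroup.mem_bot] at hxC
    exact hcon ⟨_, indet_mem_wordsOver B, indet_ne_one Γ, by rw [subst_indet, hxC]⟩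
  · have hk : ¬ LocalRankLE B k := by
      rw [← localRank_subgroup_le_iff, ← hr, not_le]
      exact_mod_cast k.lt_succ_self
    simp only [LocalRankLE, not_forall] at hk
    -- `B₀` witnesses that the local rank of `B` exceeds `k`.
    obtain ⟨B₀, hB₀B, hB₀, hk⟩ := hk
    obtain ⟨C, hDC, hCB, S, hS, rfl⟩ :=
      hx (B₀ ⊔ Subgroup.zpowers x) (sup_le_sup_right hB₀B _) (hB₀.sup (fg_zpowers x))
    have hlift : ∀ s ∈ S, ∃ w ∈ wordsOver B, subst x w = s := fun s hs ↦ by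
      have := hCB (Subgroup.subset_closure hs)
      rwa [← map_subst_wordsOver] at this
    choose! σ hσ hσs using hlift
    let K : Subgroup (Words Γ) := Subgroup.closure (S.image σ : Finset _)
    have hKgen : IsGenLE K (k + 1) := ⟨_, Finset.card_image_le.trans hS, rfl⟩
    have hKB : K ≤ wordsOver B := by
      rw [Subgroup.closure_le, Finset.coe_image]
      rintro _ ⟨s, hs, rfl⟩
      exact hσ s hs
    have hKmap : Subgroup.closure (S : Set Γ) ≤ K.map (subst x) := by
      rw [Subgroup.closure_le]
      intro s hs
      exact ⟨σ s, Subgroup.subset_closure (Finset.mem_image_of_mem σ hs), hσs s hs⟩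
    have hmem {v : Words Γ} (hv : v ∈ wordsOver B)
        (h : subst x v ∈ B₀ ⊔ Subgroup.zpowers x) : v ∈ K := by
      obtain ⟨u, hu, huv⟩ := hKmap (hDC h)
      exact hinj (hKB hu) hv huv ▸ hu
    have hindet : indet Γ ∈ K := hmem (indet_mem_wordsOver B) (by
      rw [subst_indet]; exact Subgroup.mem_sup_right (Subgroup.mem_zpowers x))
    have hB₀K : B₀ ≤ K.map (subst 1) := fun b hb ↦
      ⟨Monoid.Coprod.inl b, hmem (inl_mem_wordsOver (hB₀B hb)) (Subgroup.mem_sup_left hb), rfl⟩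
    have hKB' : K.map (subst 1) ≤ B := by
      refine (Subgroup.map_mono hKB).trans ?_
      rw [map_subst_wordsOver]
      simp
    have hfree := hA.isFreeGroup_of_fg (hKB'.trans hBA) (hKgen.map _).fg
    exact hk ⟨_, hB₀K, hKB', hKgen.map_of_not_injective _ hfree hindet (indet_ne_one Γ)
      (subst_indet 1)⟩


/-! ### Chains of admissible adjunctions -/

/-- `Reach A B`: the subgroup `B` is obtained from `A` by finitely many admissible adjunctions. -/
inductive Reach (A : Subgroup Γ) : Subgroup Γ → Prop
  | refl : Reach A A
  | step {B : Subgroup Γ} {x : Γ} : Reach A B → IsAdmissible B x → Reach A (adjoin B {x})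

theorem Reach.trans {A B C : Subgroup Γ} (hAB : Reach A B) (hBC : Reach B C) : Reach A C := by
  induction hBC with
  | refl => exact hAB
  | step _ hx ih => exact ih.step hx

theorem Reach.le {A B : Subgroup Γ} (h : Reach A B) : A ≤ B := by
  induction h with
  | refl => exact le_rfl
  | step _ _ ih => exact ih.trans (le_adjoin _ _)

theorem Reach.localRank_le {A B : Subgroup Γ} (h : Reach A B) : localRank B ≤ localRank A := by
  induction h with
  | refl => exact le_rfl
  | step _ hx ih => exact hx.2.trans ih

theorem Reach.isStronglyClosable {A B : Subgroup Γ} (h : Reach A B) (hA : IsStronglyClosable A) :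
    IsStronglyClosable B :=
  h.localRank_le.trans_lt hA

/-- Each adjoined element is algebraic over its stage, hence over the join of that stage with `A`,
hence admissible there. -/
theorem Reach.sup {A B B' : Subgroup Γ} (h : Reach B B') (hA : IsStronglyClosable A)
    (hBA : B ≤ A) (hB : localRank B < ⊤) : Reach A (A ⊔ B') := by
  induction h with
  | refl => rw [sup_eq_left.2 hBA]; exact .refl
  | @step B' x hB' hx ih =>
    have hAB' := ih.isStronglyClosable hA
    have halg := isAlgebraicOver_of_localRank_le hAB' le_sup_right
      (hB'.localRank_le.trans_lt hB) hx.2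
    have := ih.step (hAB'.isAdmissible (halg.mono le_sup_right))
    rwa [adjoin_singleton, sup_assoc, ← adjoin_singleton] at this

theorem IsStronglyClosable.isAdmissible_of_mem {A : Subgroup Γ} (hA : IsStronglyClosable A) {x : Γ}
    (hx : x ∈ A) : IsAdmissible A x := by
  rw [IsAdmissible, adjoin_singleton_of_mem hx]
  exact ⟨hA, le_rfl⟩

/-- If `A` is not strongly closable, the `z` from closability works because `iof Γ ≤ localRank A`.
-/
theorem IsClosable.exists_isAdmissible {A : Subgroup Γ} (hA : IsClosable A) :
    ∃ z, IsAdmissible A z := by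
  by_cases h : IsStronglyClosable A
  · exact ⟨1, h.isAdmissible_of_mem (one_mem A)⟩
  · obtain ⟨-, z, hz⟩ := hA
    exact ⟨z, hz, hz.le.trans (not_lt.1 h)⟩

theorem adjoin_insert (A : Subgroup Γ) (S : Set Γ) (x : Γ) :
    adjoin A (insert x S) = adjoin (adjoin A S) {x} := by
  rw [adjoin_singleton]
  simp only [adjoin, Subgroup.closure_union, Subgroup.zpowers_eq_closure, sup_assoc]
  rw [← Set.union_singleton, Subgroup.closure_union]

theorem adjoin_empty (A : Subgroup Γ) : adjoin A ∅ = A := by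
  rw [adjoin, Set.union_empty, Subgroup.closure_eq]

theorem IsAdmissibleSeq.reach {A : Subgroup Γ} {m : ℕ} {x : Fin m → Γ} (hx : IsAdmissibleSeq A x)
    (k : ℕ) (hk : k ≤ m) : Reach A (adjoin A (x '' {j | (j : ℕ) < k})) := by
  induction k with
  | zero => simpa [adjoin_empty] using Reach.refl
  | succ k ih =>
    have h := (ih (by omega)).step (hx ⟨k, hk⟩)
    have hset : {j : Fin m | (j : ℕ) < k + 1} = insert ⟨k, hk⟩ {j : Fin m | (j : ℕ) < k} := by
      ext j
      simp only [Set.mem_ofPred_eq, Set.mem_insert_iff, Fin.ext_iff]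
      omega
    rwa [hset, Set.image_insert_eq, adjoin_insert]

theorem IsAdmissibleSeq.snoc {A : Subgroup Γ} {m : ℕ} {x : Fin m → Γ} (hx : IsAdmissibleSeq A x)
    {g : Γ} (hg : IsAdmissible (adjoin A (Set.range x)) g) :
    IsAdmissibleSeq A (Fin.snoc x g : Fin (m + 1) → Γ) := by
  intro i
  refine Fin.lastCases ?_ (fun i ↦ ?_) i
  · have : (Fin.snoc x g : Fin (m + 1) → Γ) '' {j | j < Fin.last m} = Set.range x := by
      ext y
      constructor
      · rintro ⟨j, hj, rfl⟩
        obtain ⟨j, rfl⟩ := Fin.exists_castSucc_eq.2 (Fin.lt_last_iff_ne_last.1 hj)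
        exact ⟨j, by simp⟩
      · rintro ⟨j, rfl⟩
        exact ⟨j.castSucc, Fin.castSucc_lt_last j, by simp⟩
    rw [this, Fin.snoc_last]
    exact hg
  · have : (Fin.snoc x g : Fin (m + 1) → Γ) '' {j | j < i.castSucc} = x '' {j | j < i} := by
      ext y
      constructor
      · rintro ⟨j, hj, rfl⟩
        obtain ⟨j, rfl⟩ := Fin.exists_castSucc_eq.2
          (Fin.lt_last_iff_ne_last.1 (hj.trans (Fin.castSucc_lt_last i)))
        exact ⟨j, by simpa using hj, by simp⟩
      · rintro ⟨j, hj, rfl⟩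
        exact ⟨j.castSucc, by simpa using hj, by simp⟩
    rw [this, Fin.snoc_castSucc]
    exact hx i

theorem Reach.exists_isAdmissibleSeq {A B : Subgroup Γ} (h : Reach A B) :
    ∃ (m : ℕ) (x : Fin m → Γ), IsAdmissibleSeq A x ∧ adjoin A (Set.range x) = B := by
  induction h with
  | refl => exact ⟨0, Fin.elim0, fun i ↦ i.elim0, by rw [Set.range_eq_empty, adjoin_empty]⟩
  | @step B g _ hg ih =>
    obtain ⟨m, x, hx, rfl⟩ := ih
    exact ⟨m + 1, Fin.snoc x g, hx.snoc hg, by rw [Fin.range_snoc, adjoin_insert]⟩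

theorem mem_cl_iff {A : Subgroup Γ} {g : Γ} :
    g ∈ cl A ↔ ∃ B, Reach A B ∧ IsAdmissible B g := by
  constructor
  · rintro ⟨m, x, hx, rfl⟩
    exact ⟨_, hx.reach m m.le_succ, hx (Fin.last m)⟩
  · rintro ⟨B, hB, hg⟩
    obtain ⟨m, x, hx, rfl⟩ := hB.exists_isAdmissibleSeq
    exact ⟨m, Fin.snoc x g, hx.snoc hg, Fin.snoc_last _ _⟩

theorem cl_subset_of_reach {A B : Subgroup Γ} (hA : IsStronglyClosable A) (hBA : B ≤ A)
    (hB : localRank B < ⊤) {g : Γ} (hg : g ∈ cl B) : ∃ D, Reach A D ∧ g ∈ D := by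
  obtain ⟨B', hB', hg⟩ := mem_cl_iff.1 hg
  exact ⟨_, (hB'.step hg).sup hA hBA hB, Subgroup.mem_sup_right (mem_adjoin_singleton _ _)⟩

theorem mem_cl_of_reach {A B : Subgroup Γ} (h : Reach A B) (hB : IsStronglyClosable B) {g : Γ}
    (hg : g ∈ B) : g ∈ cl A :=
  mem_cl_iff.2 ⟨B, h, hB.isAdmissible_of_mem hg⟩

theorem directedOn_reach {A : Subgroup Γ} (hA : IsStronglyClosable A) :
    DirectedOn (· ≤ ·) {B | Reach A B} := fun B hB B' hB' ↦
  ⟨B ⊔ B', Reach.trans hB (Reach.sup hB' (Reach.isStronglyClosable hB hA) (Reach.le hB)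
    (lt_of_lt_of_le hA le_top)), le_sup_left, le_sup_right⟩

theorem exists_le_of_fg_of_directedOn {F : Set (Subgroup Γ)} (hF : DirectedOn (· ≤ ·) F)
    (hne : F.Nonempty) {D : Subgroup Γ} (hD : D.FG) (hDF : D ≤ sSup F) : ∃ B ∈ F, D ≤ B := by
  classical
  obtain ⟨S, rfl⟩ := hD
  simp only [Subgroup.closure_le] at hDF ⊢
  induction S using Finset.induction_on with
  | empty => obtain ⟨B, hB⟩ := hne; exact ⟨B, hB, by simp⟩
  | insert s S _ ih =>
    rw [Finset.coe_insert, Set.insert_subset_iff] at hDF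
    obtain ⟨B, hB, hSB⟩ := ih hDF.2
    obtain ⟨C, hC, hsC⟩ := (Subgroup.mem_sSup_of_directedOn hne hF).1 hDF.1
    obtain ⟨E, hE, hBE, hCE⟩ := hF B hB C hC
    refine ⟨E, hE, ?_⟩
    rw [Finset.coe_insert, Set.insert_subset_iff]
    exact ⟨hCE hsC, hSB.trans hBE⟩

end ClosableSubgroups

/-! ### The closure as a directed union -/

open ClosableSubgroups in
theorem mainTheorem7 {Γ : Type*} [Group Γ] (A : Subgroup Γ)
    (hA : ClosableSubgroups.IsClosable A) :
    ∃ C : Subgroup Γ, (C : Set Γ) = ClosableSubgroups.cl A ∧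
      -- (1)
      ClosableSubgroups.IsStronglyClosable C ∧
      ClosableSubgroups.localRank C ≤ ClosableSubgroups.localRank A ∧
      -- (2)
      A ≤ C ∧
      -- (3)
      (∀ B : Subgroup Γ, ClosableSubgroups.IsClosable B → B ≤ A →
        ClosableSubgroups.cl B ⊆ ClosableSubgroups.cl A) ∧
      -- (4)
      ClosableSubgroups.IsClosable C ∧
      ClosableSubgroups.cl C = ClosableSubgroups.cl A := by
  obtain ⟨z, hz⟩ := hA.exists_isAdmissible
  -- `A` itself need not be strongly closable; one admissible step makes it so.
  set A₁ := adjoin A {z}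
  have hA₁ : IsStronglyClosable A₁ := hz.1
  have hAA₁ : Reach A A₁ := Reach.refl.step hz
  set F : Set (Subgroup Γ) := {B | Reach A₁ B}
  have hF : DirectedOn (· ≤ ·) F := directedOn_reach hA₁
  have hne : F.Nonempty := ⟨A₁, Reach.refl⟩
  have hFsc {B : Subgroup Γ} (hB : B ∈ F) : IsStronglyClosable B :=
    Reach.isStronglyClosable hB hA₁
  have hmem {g : Γ} : g ∈ sSup F ↔ ∃ B ∈ F, g ∈ B := Subgroup.mem_sSup_of_directedOn hne hF
  have hsub {g : Γ} (hg : g ∈ sSup F) : g ∈ cl A := by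
    obtain ⟨B, hB, hg⟩ := hmem.1 hg
    exact mem_cl_of_reach (hAA₁.trans hB) (hFsc hB) hg
  have hA₁C : A₁ ≤ sSup F := le_sSup Reach.refl
  have hCA₁ : localRank (sSup F : Subgroup Γ) ≤ localRank A₁ := by
    obtain ⟨n, hn, -⟩ := hA₁.exists_nat
    rw [hn, localRank_subgroup_le_iff]
    intro D hDF hD
    obtain ⟨B, hB, hDB⟩ := exists_le_of_fg_of_directedOn hF hne hD hDF
    obtain ⟨E, hDE, hEB, hE⟩ :=
      localRank_subgroup_le_iff.1 ((Reach.localRank_le hB).trans hn.le) D hDB hD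
    exact ⟨E, hDE, hEB.trans (le_sSup hB), hE⟩
  have hC : IsStronglyClosable (sSup F) := hCA₁.trans_lt hA₁
  have hCtop : localRank (sSup F : Subgroup Γ) < ⊤ := lt_of_lt_of_le hC le_top
  have hclB {B : Subgroup Γ} (hB : IsClosable B) (hBA : B ≤ A) {g : Γ} (hg : g ∈ cl B) :
      g ∈ sSup F :=
    hmem.2 (cl_subset_of_reach hA₁ (hBA.trans hAA₁.le) hB.1 hg)
  have hcl : ((sSup F : Subgroup Γ) : Set Γ) = cl A :=
    Set.Subset.antisymm (fun g hg ↦ hsub hg) fun g hg ↦ hclB hA le_rfl hg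
  -- The coefficients of an equation for `x` over the union already lie in one reached subgroup,
  -- where `x` can be adjoined.
  have hadm {x : Γ} (hx : IsAdmissible (sSup F) x) : x ∈ sSup F := by
    obtain ⟨B₀, hB₀C, hB₀, hxB₀⟩ :=
      (isAlgebraicOver_of_localRank_le hC le_rfl hCtop hx.2).exists_fg
    obtain ⟨B, hB, hB₀B⟩ := exists_le_of_fg_of_directedOn hF hne hB₀ hB₀C
    exact hmem.2 ⟨_, Reach.step hB ((hFsc hB).isAdmissible (hxB₀.mono hB₀B)),
      mem_adjoin_singleton _ _⟩
  have hreach {D : Subgroup Γ} (hD : Reach (sSup F) D) : D = sSup F := by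
    induction hD with
    | refl => rfl
    | step _ hx ih => subst ih; exact adjoin_singleton_of_mem (hadm hx)
  refine ⟨sSup F, hcl, hC, hCA₁.trans hz.2, hAA₁.le.trans hA₁C, fun B hB hBA g hg ↦
    hsub (hclB hB hBA hg), ⟨hCtop, 1, ?_⟩, ?_⟩
  · rw [adjoin_singleton_of_mem (one_mem _)]
    exact hC
  · rw [← hcl]
    refine Set.Subset.antisymm (fun g hg ↦ ?_) fun g hg ↦ mem_cl_of_reach .refl hC hg
    obtain ⟨D, hD, hg⟩ := mem_cl_iff.1 hg
    rw [hreach hD] at hg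
    exact hadm hg
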